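/- Let $K,N_T,N_R\ge 1$ be integers, $R>0$ and $\gamma_1,\dots,\gamma_K>0$. For $k=1,\dots,K$ let $\mathbf u_k\sim\mathcal{CN}(\mathbf 0,\mathbf I_{N_R})$ and $\mathbf v_k\sim\mathcal{CN}(\mathbf 0,\mathbf I_{N_T})$ be independent complex Gaussian random vectors (the entries are i.i.d., and the real and imaginary parts of each entry are independent $\mathcal N(0,\tfrac12)$), let $\mathbf H_k=\mathbf u_k\mathbf v_k^{\mathrm H}$ be the rank-one keyhole channel matrix of the $k$-th round, and assume that $\mathbf H_1,\dots,\mathbf H_K$ are independent. Then the outage probability of Type-I HARQ at rate $R$ is $$ \Pr\Big(\max_{1\le k\le K}\log_2\det\Big(\mathbf I_{N_R}+\frac{\gamma_k}{N_T}\mathbf H_k\mathbf H_k^{\mathrm H}\Big)<R\Big) =\frac{1}{\big(\Gamma(N_T)\Gamma(N_R)\big)^{K}}\prod_{k=1}^{K} G^{2,1}_{1,3}\!\left(\left.\begin{matrix}1\\ N_T,\,N_R,\,0\end{matrix}\,\right|\,\frac{N_T}{\gamma_k}\,(2^R-1)\right). $$ Here $G^{m,n}_{p,q}$ is Meijer's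 G-function, $$ G^{m,n}_{p,q}\!\left(\left.\begin{matrix}a_1,\dots,a_p\\ b_1,\dots,b_q\end{matrix}\,\right|\,z\right) =\frac1{2\pi i}\int_{c-i\infty}^{c+i\infty} \frac{\prod_{j=1}^m\Gamma(b_j-s)\,\prod_{j=1}^n\Gamma(1-a_j+s)}{\prod_{j=m+1}^q\Gamma(1-b_j+s)\,\prod_{j=n+1}^p\Gamma(a_j-s)}\,z^s\,ds , $$ where the line $\operatorname{Re}s=c$ has the poles of $\Gamma(b_j-s)$, $j\le m$, on its right and the poles of $\Gamma(1-a_j+s)$, $j\le n$, on its left. For the parameters and arguments above such lines exist (those with $0<c<\min(N_T,N_R)$), and along each of them the integral converges absolutely and has the same value. -/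

import Mathlib

open MeasureTheory ProbabilityTheory

noncomputable section

/-! ### Meijer's G-function -/

/-- The Mellin-Barnes integrand of `G^{m,n}_{p,q}(a; b | z)`, namely
`∏_{j ≤ m} Γ(b_j - s) ∏_{j ≤ n} Γ(1 - a_j + s) /
  (∏_{m < j ≤ q} Γ(1 - b_j + s) ∏_{n < j ≤ p} Γ(a_j - s)) * z ^ s`.
(The index `j : Fin q` stands for the parameter number `j + 1`. The reciprocal Gamma function
takes the value `0` at the poles of `Γ`, which is also what `(Complex.Gamma _)⁻¹` gives.) -/
def meijerGIntegrand (m n : ℕ) {p q : ℕ} (a : Fin p → ℂ) (b : Fin q → ℂ) (z s : ℂ) : ℂ :=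
  (∏ j : Fin q, if (j : ℕ) < m then Complex.Gamma (b j - s) else (Complex.Gamma (1 - b j + s))⁻¹) *
  (∏ j : Fin p, if (j : ℕ) < n then Complex.Gamma (1 - a j + s) else (Complex.Gamma (a j - s))⁻¹) *
  z ^ s

/-- The vertical line `Re s = c` separates the poles of the integrand: those of `Γ(b_j - s)`,
`j ≤ m`, i.e. the points `b_j + k`, lie to its right and those of `Γ(1 - a_j + s)`, `j ≤ n`,
i.e. the points `a_j - 1 - k`, lie to its left (`k = 0, 1, 2, …`). -/
def MeijerGSeparates (m n : ℕ) {p q : ℕ} (a : Fin p → ℂ) (b : Fin q → ℂ) (c : ℝ) : Prop :=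
  (∀ j : Fin q, (j : ℕ) < m → ∀ k : ℕ, c < (b j + k).re) ∧
  (∀ j : Fin p, (j : ℕ) < n → ∀ k : ℕ, (a j - 1 - k).re < c)

/-- `1 / (2 π i) ∫_{c - i ∞}^{c + i ∞}` of the integrand, with the line parametrised as
`s = c + i t`, `ds = i dt`. -/
def meijerGLine (m n : ℕ) {p q : ℕ} (a : Fin p → ℂ) (b : Fin q → ℂ) (c : ℝ) (z : ℂ) : ℂ :=
  (2 * (Real.pi : ℂ))⁻¹ * ∫ t : ℝ, meijerGIntegrand m n a b z ((c : ℂ) + (t : ℂ) * Complex.I)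

open Classical in
/-- Meijer's G-function `G^{m,n}_{p,q}(a; b | z)`, for parameters whose two families of poles can be
separated by a vertical line: the Mellin-Barnes integral along such a line. That it does not matter
which separating line is taken, and that the integral converges, is `MeijerGWellDefined`. -/
def meijerG (m n : ℕ) {p q : ℕ} (a : Fin p → ℂ) (b : Fin q → ℂ) (z : ℂ) : ℂ :=
  if h : ∃ c : ℝ, MeijerGSeparates m n a b c then meijerGLine m n a b h.choose z else 0

/-- There is a separating vertical line, and along every such line the Mellin-Barnes integral
converges absolutely and has the value `meijerG m n a b z`. -/
def MeijerGWellDefined (m n : ℕ) {p q : ℕ} (a : Fin p → ℂ) (b : Fin q → ℂ) (z : ℂ) : Prop :=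
  (∃ c : ℝ, MeijerGSeparates m n a b c) ∧
  ∀ c : ℝ, MeijerGSeparates m n a b c →
    Integrable (fun t : ℝ => meijerGIntegrand m n a b z ((c : ℂ) + (t : ℂ) * Complex.I)) ∧
    meijerGLine m n a b c z = meijerG m n a b z

/-! ### Keyhole channels -/

/-- The law `CN(0, 1)` on `ℂ`: real and imaginary part are independent, each `N(0, 1/2)`. -/
def complexGaussian : Measure ℂ :=
  ((gaussianReal 0 (1 / 2)).prod (gaussianReal 0 (1 / 2))).map
    (fun x : ℝ × ℝ => (x.1 : ℂ) + (x.2 : ℂ) * Complex.I)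

/-- The law `CN(0, I_N)` on `ℂ^N`: the coordinates are i.i.d. `CN(0, 1)`. -/
def complexGaussianVector (N : ℕ) : Measure (Fin N → ℂ) :=
  Measure.pi (fun _ => complexGaussian)

/-- Matrices carry the product σ-algebra of their entries. -/
instance matrixMeasurableSpace {m n : Type*} : MeasurableSpace (Matrix m n ℂ) :=
  inferInstanceAs (MeasurableSpace (m → n → ℂ))

/-- The keyhole channel matrix `u vᴴ`, with entries `u_i * conj v_j`. -/
def keyholeChannel {NR NT : ℕ} (u : Fin NR → ℂ) (v : Fin NT → ℂ) : Matrix (Fin NR) (Fin NT) ℂ :=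
  Matrix.vecMulVec u (star v)

/-- The mutual information `log₂ det (I + (γ / N_T) H Hᴴ)` of one round. (The matrix is Hermitian,
so its determinant is a real number.) -/
def mutualInfo {NR NT : ℕ} (γ : ℝ) (H : Matrix (Fin NR) (Fin NT) ℂ) : ℝ :=
  Real.logb 2 (1 + ((γ / NT : ℝ) : ℂ) • (H * H.conjTranspose)).det.re

/-- The accumulated mutual information of Type-I HARQ after `K ≥ 1` rounds: the maximum over the
rounds. -/
def typeIMutualInfo {K NR NT : ℕ} [NeZero K] (γ : Fin K → ℝ)
    (H : Fin K → Matrix (Fin NR) (Fin NT) ℂ) : ℝ :=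
  Finset.univ.sup' Finset.univ_nonempty (fun k => mutualInfo (γ k) (H k))

/-- The outage probability: the probability that the accumulated mutual information is less than
the rate `R`. -/
def outageProbability {Ω : Type*} [MeasurableSpace Ω] (P : Measure Ω) {K NR NT : ℕ} [NeZero K]
    (γ : Fin K → ℝ) (H : Fin K → Ω → Matrix (Fin NR) (Fin NT) ℂ) (R : ℝ) : ℝ :=
  P.real {ω | typeIMutualInfo γ (fun k => H k ω) < R}

end

/-! The channel has rank one, so the matrix determinant lemma gives `det (I + (γ / N_T) H Hᴴ) = 1 +
(γ / N_T) ‖u‖² ‖v‖²`. Round `k` therefore fails exactly when `W = ‖u‖² ‖v‖²` lies below `x = (N_T /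
γ_k) (2 ^ R - 1)`. The maximum is below `R` iff every round fails, and independence turns this into
a product.

It remains to identify `F(x) = P(W < x)`. Characteristic functions show that `‖u‖²` and `‖v‖²` are
Gamma distributed with shapes `N_R` and `N_T`, so `E W ^ (-s) = Γ(N_R - s) Γ(N_T - s) / (Γ(N_R)
Γ(N_T))`. By Fubini the Mellin transform of `F` at `-s` is `E W ^ (-s) / s` (`mellin_cdf`), and
Mellin inversion (`inverse_mellin_cdf`) recovers `F`. Since `Γ(s) / Γ(1 + s) = 1 / s`, the inversion
integral is the Mellin-Barnes integral up to the Gamma constants. Inversion works on every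
separating line, which also yields the well-definedness. -/

/-! ### Characteristic functions of Gamma laws -/

lemma integrableOn_pow_mul_cexp_neg_mul_Ioi (n : ℕ) {b : ℂ} (hb : 0 < b.re) :
    IntegrableOn (fun x : ℝ => (x : ℂ) ^ n * Complex.exp (-b * x)) (Set.Ioi 0) := by
  have h := integrableOn_rpow_mul_exp_neg_mul_rpow (s := n) (p := 1) (b := b.re)
    (by have : (0 : ℝ) ≤ n := n.cast_nonneg
        linarith) one_pos hb
  refine Integrable.mono' h (by fun_prop) ?_
  filter_upwards [ae_restrict_mem measurableSet_Ioi] with x hx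
  have hx' : 0 < x := hx
  simp [Complex.norm_exp, abs_of_pos hx']

lemma tendsto_pow_mul_cexp_neg_mul_atTop (n : ℕ) {b : ℂ} (hb : 0 < b.re) :
    Filter.Tendsto (fun x : ℝ => (x : ℂ) ^ n * Complex.exp (-b * x)) Filter.atTop (nhds 0) := by
  rw [tendsto_zero_iff_norm_tendsto_zero]
  refine (tendsto_rpow_mul_exp_neg_mul_atTop_nhds_zero n b.re hb).congr' ?_
  filter_upwards [Filter.eventually_gt_atTop 0] with x hx
  simp [Complex.norm_exp, abs_of_pos hx]

/-- `∫₀^∞ x ^ n exp (-b x) dx = n! / b ^ (n + 1)` for complex `b` of positive real part. -/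
lemma integral_pow_mul_cexp_neg_mul_Ioi (n : ℕ) {b : ℂ} (hb : 0 < b.re) :
    ∫ x : ℝ in Set.Ioi 0, (x : ℂ) ^ n * Complex.exp (-b * x) =
      (n.factorial : ℂ) / b ^ (n + 1) := by
  have hb0 : b ≠ 0 := fun h => by simp [h] at hb
  induction n with
  | zero =>
    have := integral_exp_mul_complex_Ioi (a := -b) (by simpa using hb) 0
    simpa using this
  | succ n ih =>
    have hI := integrableOn_pow_mul_cexp_neg_mul_Ioi n hb
    have hI' := integrableOn_pow_mul_cexp_neg_mul_Ioi (n + 1) hb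
    -- `x ^ (n + 1) * exp (-b x)` vanishes at `0` and at infinity, so its derivative integrates to
    -- `0`; this is the recursion `b * I (n + 1) = (n + 1) * I n`.
    have hd : ∀ x ∈ Set.Ici (0 : ℝ),
        HasDerivAt (fun x : ℝ => (x : ℂ) ^ (n + 1) * Complex.exp (-b * x))
        ((n + 1 : ℂ) * ((x : ℂ) ^ n * Complex.exp (-b * x)) -
          b * ((x : ℂ) ^ (n + 1) * Complex.exp (-b * x))) x := by
      intro x _
      have h1 : HasDerivAt (fun z : ℂ => z ^ (n + 1) * Complex.exp (-b * z)) _ (x : ℂ) :=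
        (hasDerivAt_pow (n + 1) (x : ℂ)).mul (((hasDerivAt_id (x : ℂ)).const_mul (-b)).cexp)
      convert! h1.comp_ofReal using 1
      simp
      ring
    have := integral_Ioi_of_hasDerivAt_of_tendsto' hd
      ((hI.const_mul _).sub (hI'.const_mul _)) (tendsto_pow_mul_cexp_neg_mul_atTop (n + 1) hb)
    rw [integral_sub (hI.const_mul _) (hI'.const_mul _), integral_const_mul, integral_const_mul,
      ih] at this
    simp only [Complex.ofReal_zero, ne_eq, Nat.add_eq_zero_iff, one_ne_zero, and_false,
      not_false_eq_true, zero_pow, zero_mul, sub_self] at this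
    rw [eq_div_iff (pow_ne_zero _ hb0), pow_succ b (n + 1), ← mul_assoc, mul_right_comm,
      mul_comm _ b, ← sub_eq_zero.1 this, Nat.factorial_succ]
    field_simp
    push_cast
    ring

lemma measurable_gammaPDF (a r : ℝ) : Measurable (gammaPDF a r) :=
  (measurable_gammaPDFReal a r).ennreal_ofReal

lemma integral_gammaMeasure_one {a : ℝ} (ha : 0 < a) (f : ℝ → ℂ) :
    ∫ x, f x ∂gammaMeasure a 1 =
      (Complex.Gamma a)⁻¹ *
        ∫ x in Set.Ioi 0, ((x ^ (a - 1) * Real.exp (-x) : ℝ) : ℂ) * f x := by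
  rw [gammaMeasure, integral_withDensity_eq_integral_toReal_smul
    (measurable_gammaPDF a 1) (ae_of_all _ fun _ => ENNReal.ofReal_lt_top),
    ← integral_const_mul, ← integral_Ici_eq_integral_Ioi, ← integral_indicator measurableSet_Ici]
  refine integral_congr_ae (ae_of_all _ fun x => ?_)
  simp only [gammaPDF]
  rw [ENNReal.toReal_ofReal (gammaPDFReal_nonneg ha one_pos x), Set.indicator_apply,
    Complex.real_smul]
  by_cases hx : 0 ≤ x
  · rw [if_pos (Set.mem_Ici.2 hx), gammaPDFReal, if_pos hx, Complex.Gamma_ofReal]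
    push_cast
    simp
    ring
  · rw [if_neg (by simpa using hx), gammaPDFReal, if_neg hx]
    simp

lemma integrable_gammaMeasure_one {a : ℝ} (ha : 0 < a) {f : ℝ → ℝ}
    (hf : IntegrableOn (fun x => x ^ (a - 1) * Real.exp (-x) * f x) (Set.Ioi 0)) :
    Integrable f (gammaMeasure a 1) := by
  rw [gammaMeasure, integrable_withDensity_iff (measurable_gammaPDF a 1)
    (ae_of_all _ fun _ => ENNReal.ofReal_lt_top)]
  rw [← integrableOn_Ici_iff_integrableOn_Ioi, ← integrable_indicator_iff measurableSet_Ici] at hf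
  refine (hf.const_mul (Real.Gamma a)⁻¹).congr (ae_of_all _ fun x => ?_)
  simp only [gammaPDF]
  rw [ENNReal.toReal_ofReal (gammaPDFReal_nonneg ha one_pos x), Set.indicator_apply]
  by_cases hx : 0 ≤ x
  · rw [if_pos (Set.mem_Ici.2 hx), gammaPDFReal, if_pos hx]
    simp
    ring
  · rw [if_neg (by simpa using hx), gammaPDFReal, if_neg hx]
    simp

lemma charFun_gammaMeasure_nat {n : ℕ} (hn : 0 < n) (t : ℝ) :
    charFun (gammaMeasure n 1) t = ((1 - t * Complex.I)⁻¹) ^ n := by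
  obtain ⟨m, rfl⟩ := Nat.exists_eq_add_one.2 hn
  rw [charFun_apply_real, integral_gammaMeasure_one (by positivity)]
  have h := integral_pow_mul_cexp_neg_mul_Ioi m (b := 1 - t * Complex.I) (by simp)
  rw [Complex.Gamma_ofReal, show ((m + 1 : ℕ) : ℝ) = (m : ℝ) + 1 by push_cast; ring,
    Real.Gamma_nat_eq_factorial]
  have : ∫ x in Set.Ioi (0 : ℝ), ((x ^ ((m : ℝ) + 1 - 1) * Real.exp (-x) : ℝ) : ℂ) *
      Complex.exp (t * x * Complex.I) =
      ∫ x : ℝ in Set.Ioi 0, (x : ℂ) ^ m * Complex.exp (-(1 - t * Complex.I) * x) := by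
    refine setIntegral_congr_fun measurableSet_Ioi fun x _ => ?_
    simp only [add_sub_cancel_right, Real.rpow_natCast]
    push_cast
    rw [mul_assoc, ← Complex.exp_add]
    ring_nf
  rw [this, h, inv_pow]
  have : (m.factorial : ℂ) ≠ 0 := by exact_mod_cast m.factorial_ne_zero
  push_cast
  field_simp

/-! ### Squared norms of complex Gaussian vectors -/

lemma integral_cexp_sq_gaussianReal_half (t : ℝ) :
    ∫ x, Complex.exp (t * x ^ 2 * Complex.I) ∂gaussianReal 0 (1 / 2) =
      (Real.pi : ℂ) ^ (-(1 / 2) : ℂ) * (Real.pi / (1 - t * Complex.I)) ^ (1 / 2 : ℂ) := by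
  rw [integral_gaussianReal_eq_integral_smul (by norm_num),
    ← integral_gaussian_complex (b := 1 - t * Complex.I) (by simp), ← integral_const_mul]
  refine integral_congr_ae (ae_of_all _ fun x => ?_)
  have h2 : (√Real.pi)⁻¹ = Real.pi ^ (-(1 / 2) : ℝ) := by
    rw [Real.sqrt_eq_rpow, Real.rpow_neg Real.pi_pos.le]
  have h : gaussianPDFReal 0 (1 / 2) x = Real.pi ^ (-(1 / 2) : ℝ) * Real.exp (-x ^ 2) := by
    rw [← h2]
    simp [gaussianPDFReal]
    field_simp
  simp only [h, Complex.real_smul]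
  push_cast
  rw [Complex.ofReal_cpow Real.pi_pos.le, mul_assoc, ← Complex.exp_add]
  push_cast
  ring_nf

lemma integral_cexp_normSq_complexGaussian (t : ℝ) :
    ∫ z, Complex.exp (t * Complex.normSq z * Complex.I) ∂complexGaussian =
      (1 - t * Complex.I)⁻¹ := by
  have hpi : (Real.pi : ℂ) ≠ 0 := by exact_mod_cast Real.pi_ne_zero
  rw [complexGaussian, integral_map (by fun_prop) (by fun_prop)]
  have : ∀ x : ℝ × ℝ,
      Complex.exp (t * Complex.normSq ((x.1 : ℂ) + (x.2 : ℂ) * Complex.I) * Complex.I) =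
      Complex.exp (t * x.1 ^ 2 * Complex.I) * Complex.exp (t * x.2 ^ 2 * Complex.I) := by
    intro x
    rw [Complex.normSq_add_mul_I, ← Complex.exp_add]
    push_cast
    ring_nf
  simp_rw [this]
  -- Both factors are the same principal square root; only its square matters, so no branch has to
  -- be identified.
  rw [integral_prod_mul (fun x : ℝ => Complex.exp (t * x ^ 2 * Complex.I))
    (fun x : ℝ => Complex.exp (t * x ^ 2 * Complex.I)), integral_cexp_sq_gaussianReal_half,
    ← pow_two, mul_pow, ← Complex.cpow_nat_mul, ← Complex.cpow_nat_mul]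
  norm_num
  rw [Complex.cpow_neg_one]
  field_simp

instance isProbabilityMeasure_complexGaussian : IsProbabilityMeasure complexGaussian :=
  Measure.isProbabilityMeasure_map (by fun_prop)

instance isProbabilityMeasure_complexGaussianVector (N : ℕ) :
    IsProbabilityMeasure (complexGaussianVector N) := by
  unfold complexGaussianVector
  infer_instance

/-- The squared norm of a standard complex Gaussian vector has a Gamma law. -/
lemma hasLaw_sum_normSq_complexGaussianVector {N : ℕ} (hN : 0 < N) :
    HasLaw (fun u : Fin N → ℂ => ∑ i, Complex.normSq (u i)) (gammaMeasure N 1)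
      (complexGaussianVector N) where
  aemeasurable := (Finset.measurable_sum _ fun i _ =>
    Complex.continuous_normSq.measurable.comp (measurable_pi_apply i)).aemeasurable
  map_eq := by
    have hm : Measurable (fun u : Fin N → ℂ => ∑ i, Complex.normSq (u i)) := 
      Finset.measurable_sum _ fun i _ =>
        Complex.continuous_normSq.measurable.comp (measurable_pi_apply i)
    have := isProbabilityMeasure_gammaMeasure (a := N) (r := 1) (by exact_mod_cast hN) one_pos
    have := Measure.isProbabilityMeasure_map (μ := complexGaussianVector N) hm.aemeasurable
    refine Measure.ext_of_charFun (funext fun t => ?_)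
    rw [charFun_gammaMeasure_nat hN, charFun_apply_real, integral_map hm.aemeasurable (by fun_prop),
      ← integral_cexp_normSq_complexGaussian, complexGaussianVector]
    have h := integral_fintype_prod_eq_pow (ι := Fin N)
      (fun z => Complex.exp (t * Complex.normSq z * Complex.I)) (μ := complexGaussian)
    rw [Fintype.card_fin] at h
    rw [← h]
    refine integral_congr_ae (ae_of_all _ fun u => ?_)
    simp only [← Complex.exp_sum]
    push_cast
    rw [Finset.mul_sum, Finset.sum_mul]

/-! ### Negative moments of Gamma laws -/

lemma gammaMeasure_Iic_zero (a r : ℝ) : gammaMeasure a r (Set.Iic 0) = 0 := by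
  rw [gammaMeasure, withDensity_apply _ measurableSet_Iic, setLIntegral_congr Iio_ae_eq_Iic.symm,
    lintegral_gammaPDF_of_nonpos le_rfl]

instance nullSingletonClass_gammaMeasure (a r : ℝ) :
    NullSingletonClass (gammaMeasure a r) := by
  unfold gammaMeasure
  infer_instance

/-- The negative complex moments of a Gamma law. -/
lemma integral_cpow_neg_gammaMeasure {a : ℝ} {s : ℂ} (ha : 0 < a) (hs : s.re < a) :
    ∫ x, (x : ℂ) ^ (-s) ∂gammaMeasure a 1 = Complex.Gamma (a - s) / Complex.Gamma a := by
  rw [integral_gammaMeasure_one ha, Complex.Gamma_eq_integral (s := a - s) (by simpa using hs),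
    Complex.GammaIntegral, div_eq_inv_mul]
  congr 1
  refine setIntegral_congr_fun measurableSet_Ioi fun x (hx : 0 < x) => ?_
  have hx' : (x : ℂ) ≠ 0 := by exact_mod_cast hx.ne'
  rw [Complex.ofReal_mul, Complex.ofReal_cpow hx.le, mul_right_comm, ← Complex.cpow_add _ _ hx',
    mul_comm]
  push_cast
  ring_nf

lemma integrable_rpow_neg_gammaMeasure {a c : ℝ} (ha : 0 < a) (hc : c < a) :
    Integrable (fun x => x ^ (-c)) (gammaMeasure a 1) := by
  refine integrable_gammaMeasure_one ha ?_
  refine (Real.GammaIntegral_convergent (s := a - c) (by linarith)).congr_fun ?_ measurableSet_Ioi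
  intro x (hx : 0 < x)
  simp only
  rw [mul_right_comm, ← Real.rpow_add hx, mul_comm]
  ring_nf

/-! ### Mellin transform and inversion for distribution functions -/

section MellinCDF

variable {μ : Measure ℝ} {s : ℂ}

/-- One half of the Fubini argument: integrating the kernel in `x` produces the negative moment,
integrating it in `w` produces the distribution function. The cut-off at `w` removes the singularity
at `0`, and `0 < s.re` gives convergence at infinity. -/
lemma setIntegral_Ioi_zero_indicator_cpow {w : ℝ} (hw : 0 < w) (hs : 0 < s.re) :
    IntegrableOn (fun x : ℝ => (Set.Ioi w).indicator (fun x : ℝ => (x : ℂ) ^ (-s - 1)) x)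
        (Set.Ioi 0) ∧
      ∫ x in Set.Ioi (0 : ℝ), (Set.Ioi w).indicator (fun x : ℝ => (x : ℂ) ^ (-s - 1)) x =
        (w : ℂ) ^ (-s) / s := by
  have hlt : (-s - 1).re < -1 := by
    simp only [Complex.sub_re, Complex.neg_re, Complex.one_re]
    linarith
  have hs0 : s ≠ 0 := fun h => by simp [h] at hs
  constructor
  · exact ((integrable_indicator_iff measurableSet_Ioi).2
      (integrableOn_Ioi_cpow_of_lt hlt hw)).integrableOn
  · rw [setIntegral_indicator measurableSet_Ioi, Set.inter_eq_self_of_subset_right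
      (Set.Ioi_subset_Ioi hw.le), integral_Ioi_cpow_of_lt hlt hw, sub_add_cancel, neg_div_neg_eq]

/-- The kernel of the Mellin transform of a distribution function is integrable in both
variables. -/
lemma integrable_mellin_cdf_kernel [IsProbabilityMeasure μ] (hμ : μ (Set.Iic 0) = 0) (hs : 0 < s.re)
    (hI : Integrable (fun w => w ^ (-s.re)) μ) :
    Integrable (Function.uncurry fun (x w : ℝ) =>
        (Set.Ioi w).indicator (fun x : ℝ => (x : ℂ) ^ (-s - 1)) x)
      ((volume.restrict (Set.Ioi 0)).prod μ) := by
  have hpos : ∀ᵐ w ∂μ, 0 < w := by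
    rw [ae_iff]
    simpa [Set.Iic] using hμ
  have hmeas : Measurable (Function.uncurry fun (x w : ℝ) =>
      (Set.Ioi w).indicator (fun x : ℝ => (x : ℂ) ^ (-s - 1)) x) := by
    have : (Function.uncurry fun (x w : ℝ) =>
        (Set.Ioi w).indicator (fun x : ℝ => (x : ℂ) ^ (-s - 1)) x) =
        {p : ℝ × ℝ | p.2 < p.1}.indicator fun p => (p.1 : ℂ) ^ (-s - 1) := by
      ext p
      simp [Function.uncurry, Set.indicator_apply]
    rw [this]
    exact Measurable.indicator (by fun_prop) (measurableSet_lt measurable_snd measurable_fst)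
  rw [integrable_prod_iff' hmeas.aestronglyMeasurable]
  constructor
  · filter_upwards [hpos] with w hw
    exact (setIntegral_Ioi_zero_indicator_cpow hw hs).1
  · refine (hI.div_const s.re).congr ?_
    filter_upwards [hpos] with w hw
    -- The norm of the kernel is the kernel for the real exponent `s.re`, so the same evaluation
    -- computes the integral of the norm.
    have h := (setIntegral_Ioi_zero_indicator_cpow (s := (s.re : ℂ)) hw (by simpa using hs)).2
    have h2 : ∫ x in Set.Ioi (0 : ℝ),
        (Set.Ioi w).indicator (fun x : ℝ => (x : ℂ) ^ (-(s.re : ℂ) - 1)) x =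
        ((∫ x in Set.Ioi (0 : ℝ),
          ‖(Set.Ioi w).indicator (fun x : ℝ => (x : ℂ) ^ (-s - 1)) x‖ : ℝ) : ℂ) := by
      rw [← integral_complex_ofReal]
      refine setIntegral_congr_fun measurableSet_Ioi fun x (hx : 0 < x) => ?_
      by_cases hxw : x ∈ Set.Ioi w
      · simp only [Set.indicator_of_mem hxw, Complex.norm_cpow_eq_rpow_re_of_pos hx]
        rw [Complex.ofReal_cpow hx.le]
        simp
      · simp [Set.indicator_of_notMem hxw]
    rw [h2, ← Complex.ofReal_neg, ← Complex.ofReal_cpow hw.le, ← Complex.ofReal_div] at h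
    exact (Complex.ofReal_injective h).symm

lemma integral_mellin_cdf_kernel (x : ℝ) :
    ∫ w, (Set.Ioi w).indicator (fun x : ℝ => (x : ℂ) ^ (-s - 1)) x ∂μ =
      (x : ℂ) ^ (-s - 1) • (μ.real (Set.Iio x) : ℂ) := by
  have : (fun w => (Set.Ioi w).indicator (fun x : ℝ => (x : ℂ) ^ (-s - 1)) x) =
      (Set.Iio x).indicator fun _ => (x : ℂ) ^ (-s - 1) := by
    ext w
    simp [Set.indicator_apply]
  rw [this, integral_indicator_const _ measurableSet_Iio, Complex.real_smul, smul_eq_mul, mul_comm]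

lemma mellinConvergent_cdf [IsProbabilityMeasure μ] (hμ : μ (Set.Iic 0) = 0) (hs : 0 < s.re)
    (hI : Integrable (fun w => w ^ (-s.re)) μ) :
    MellinConvergent (fun x => (μ.real (Set.Iio x) : ℂ)) (-s) := by
  have := (integrable_mellin_cdf_kernel hμ hs hI).integral_prod_left
  simp only [Function.uncurry_apply_pair, integral_mellin_cdf_kernel] at this
  exact this

/-- The Mellin transform of a distribution function is given by the negative moments. -/
lemma mellin_cdf [IsProbabilityMeasure μ] (hμ : μ (Set.Iic 0) = 0) (hs : 0 < s.re)
    (hI : Integrable (fun w => w ^ (-s.re)) μ) :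
    mellin (fun x => (μ.real (Set.Iio x) : ℂ)) (-s) = (∫ w, (w : ℂ) ^ (-s) ∂μ) / s := by
  have hpos : ∀ᵐ w ∂μ, 0 < w := by
    rw [ae_iff]
    simpa [Set.Iic] using hμ
  have := integral_integral_swap (integrable_mellin_cdf_kernel hμ hs hI)
  simp only [integral_mellin_cdf_kernel] at this
  rw [mellin, this, ← integral_div]
  refine integral_congr_ae ?_
  filter_upwards [hpos] with w hw
  exact (setIntegral_Ioi_zero_indicator_cpow hw hs).2

end MellinCDF

/-- A jump of the distribution function would be an atom. Continuity is what makes Mellin inversion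
hold at every point. -/
lemma continuous_measureReal_Iio (μ : Measure ℝ) [IsProbabilityMeasure μ] [NullSingletonClass μ] :
    Continuous fun x => μ.real (Set.Iio x) := by
  have h : (fun x => μ.real (Set.Iio x)) = cdf μ := by
    ext x
    rw [cdf_eq_real, measureReal_congr Iio_ae_eq_Iic]
  rw [h, continuous_iff_continuousAt]
  intro x
  rw [(cdf μ).mono.continuousAt_iff_leftLim_eq_rightLim, (cdf μ).rightLim_eq]
  have h0 : (cdf μ).measure {x} = 0 := by rw [measure_cdf]; exact measure_singleton x
  rw [StieltjesFunction.measure_singleton, ENNReal.ofReal_eq_zero, sub_nonpos] at h0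
  exact le_antisymm ((cdf μ).mono.leftLim_le le_rfl) h0

/-- Recovering a distribution function on the positive half-line from the negative moments. -/
lemma inverse_mellin_cdf {μ : Measure ℝ} [IsProbabilityMeasure μ] [NullSingletonClass μ]
    (hμ : μ (Set.Iic 0) = 0) {c : ℝ} (hc : 0 < c)
    (hI : Integrable (fun w => w ^ (-c)) μ) {M : ℂ → ℂ}
    (hM : ∀ s : ℂ, s.re = c → ∫ w, (w : ℂ) ^ (-s) ∂μ = M s)
    (hint : Integrable fun t : ℝ => M (c + t * Complex.I) / (c + t * Complex.I))
    {x : ℝ} (hx : 0 < x) :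
    Integrable (fun t : ℝ => M (c + t * Complex.I) / (c + t * Complex.I) *
      (x : ℂ) ^ (c + t * Complex.I)) ∧
    (2 * (Real.pi : ℂ))⁻¹ * ∫ t : ℝ, M (c + t * Complex.I) / (c + t * Complex.I) *
      (x : ℂ) ^ (c + t * Complex.I) = μ.real (Set.Iio x) := by
  have hx0 : (x : ℂ) ≠ 0 := by exact_mod_cast hx.ne'
  -- The moments give the transform at `-s`, so the point `-c + i t` corresponds to `s = c - i t`;
  -- the reflection `t ↦ -t` is undone by `integral_neg_eq_self`.
  have hmel : ∀ t : ℝ, mellin (fun x => (μ.real (Set.Iio x) : ℂ)) ((-c : ℝ) + t * Complex.I) =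
      M (c + (-t : ℝ) * Complex.I) / (c + (-t : ℝ) * Complex.I) := by
    intro t
    have hre : ((c : ℂ) + (-t : ℝ) * Complex.I).re = c := by simp
    have := mellin_cdf (s := (c : ℂ) + (-t : ℝ) * Complex.I) hμ (by rwa [hre]) (by rwa [hre])
    rw [hM _ hre] at this
    rw [← this]
    congr 1
    push_cast
    ring
  constructor
  · refine hint.mul_bdd (c := x ^ c) 
      (Continuous.const_cpow (by fun_prop) (Or.inl hx0)).aestronglyMeasurable (ae_of_all _ fun t => ?_)
    rw [Complex.norm_cpow_eq_rpow_re_of_pos hx]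
    simp
  · have hv : Complex.VerticalIntegrable (mellin fun x => (μ.real (Set.Iio x) : ℂ)) (-c) := by
      unfold Complex.VerticalIntegrable
      simp_rw [hmel]
      exact hint.comp_neg
    have hcv : MellinConvergent (fun x => (μ.real (Set.Iio x) : ℂ)) ((-c : ℝ) : ℂ) := by
      have := mellinConvergent_cdf (s := (c : ℂ)) hμ (by simpa using hc) (by simpa using hI)
      simpa using this
    have h := mellinInv_mellin_eq (-c) _ hx hcv hv
      (Complex.continuous_ofReal.comp (continuous_measureReal_Iio μ)).continuousAt
    rw [← h, mellinInv, ← integral_neg_eq_self]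
    simp_rw [hmel]
    rw [Complex.real_smul]
    push_cast
    rw [one_div]
    congr 1
    refine integral_congr_ae (ae_of_all _ fun t => ?_)
    simp only [smul_eq_mul]
    rw [mul_comm]
    congr 2
    ring

/-! ### Decay of the Mellin-Barnes kernel -/

/-- `|Γ(σ + i t)| ≤ Γ(σ)` for `σ > 0`. -/
lemma norm_Gamma_le_Gamma_re {z : ℂ} (hz : 0 < z.re) : ‖Complex.Gamma z‖ ≤ Real.Gamma z.re := by
  rw [Complex.Gamma_eq_integral hz, Real.Gamma_eq_integral hz, Complex.GammaIntegral]
  refine (norm_integral_le_integral_norm _).trans_eq ?_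
  refine setIntegral_congr_fun measurableSet_Ioi fun x (hx : 0 < x) => ?_
  simp [Complex.norm_cpow_eq_rpow_re_of_pos hx, Complex.norm_exp]

/-- The Mellin-Barnes kernel `Γ(a - s) Γ(b - s) / s` is integrable along vertical lines. -/
lemma integrable_Gamma_mul_Gamma_div {a b c : ℝ} (hc : 0 < c) (ha : c < a) (hb : c < b) :
    Integrable fun t : ℝ => Complex.Gamma (a - (c + t * Complex.I)) *
      Complex.Gamma (b - (c + t * Complex.I)) / (c + t * Complex.I) := by
  have hcont : ∀ d : ℝ, c < d →
      Continuous fun t : ℝ => Complex.Gamma (d - (c + t * Complex.I)) := by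
    intro d hd
    rw [continuous_iff_continuousAt]
    intro t
    refine ContinuousAt.comp (g := Complex.Gamma)
      (Complex.differentiableAt_Gamma _ fun m h => ?_).continuousAt (by fun_prop)
    have := congrArg Complex.re h
    simp at this
    have : (0 : ℝ) ≤ m := m.cast_nonneg
    linarith
  have hne : ∀ t : ℝ, (c : ℂ) + t * Complex.I ≠ 0 := fun t h => by
    have := congrArg Complex.re h
    simp at this
    exact hc.ne' this
  -- `m` bounds the real parts of `s` and `a - s` from below, and `m ≤ 1` allows the same constant
  -- in front of `t ^ 2`.
  set m := min c (min (a - c) 1) with hm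
  have hm0 : 0 < m := lt_min hc (lt_min (by linarith) one_pos)
  have hm1 : m ≤ 1 := (min_le_right _ _).trans (min_le_right _ _)
  have hlow : ∀ d : ℝ, m ≤ d → ∀ t : ℝ, ∀ z : ℂ, z.re = d → |z.im| = |t| →
      m ^ 2 * (1 + t ^ 2) ≤ ‖z‖ ^ 2 := by
    intro d hd t z hre him
    rw [← Complex.normSq_eq_norm_sq, Complex.normSq_apply, hre, ← pow_two, ← pow_two,
      (sq_eq_sq_iff_abs_eq_abs _ _).2 him]
    have h1 : m ^ 2 ≤ d ^ 2 := by gcongr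
    have h2 : m ^ 2 * t ^ 2 ≤ 1 * t ^ 2 := by
      gcongr
      exact pow_le_one₀ hm0.le hm1
    linarith
  refine Integrable.mono' (integrable_inv_one_add_sq.const_mul
    (Real.Gamma (a - c + 1) * Real.Gamma (b - c) / m ^ 2))
    (((hcont a ha).mul (hcont b hb)).div (by fun_prop) hne).aestronglyMeasurable
    (ae_of_all _ fun t => ?_)
  set s : ℂ := c + t * Complex.I with hs
  set z : ℂ := a - s with hz
  have hzre : z.re = a - c := by simp [hz, hs]
  have hz0 : z ≠ 0 := fun h => by
    rw [h] at hzre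
    simp at hzre
    linarith
  -- The bound by `Γ` of the real part has no decay in `t`, and `1 / s` alone is not integrable. The
  -- functional equation supplies a second factor `1 / z`, which gives decay like `1 / (1 + t ^ 2)`.
  have hG : Complex.Gamma z = Complex.Gamma (z + 1) / z := by
    rw [Complex.Gamma_add_one z hz0]
    field_simp
  have h1 : ‖Complex.Gamma (z + 1)‖ ≤ Real.Gamma (a - c + 1) := by
    have := norm_Gamma_le_Gamma_re (z := z + 1) (by simp [hzre]; linarith)
    simpa [hzre] using this
  have h2 : ‖Complex.Gamma (b - s)‖ ≤ Real.Gamma (b - c) := by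
    have := norm_Gamma_le_Gamma_re (z := b - s) (by simp [hs]; linarith)
    simpa [hs] using this
  have hl1 := hlow (a - c) ((min_le_right _ _).trans (min_le_left _ _)) t z hzre (by simp [hz, hs])
  have hl2 := hlow c (min_le_left _ _) t s (by simp [hs]) (by simp [hs])
  have hprod : m ^ 2 * (1 + t ^ 2) ≤ ‖z‖ * ‖s‖ := by
    refine (pow_le_pow_iff_left₀ (by positivity) (by positivity) two_ne_zero).1 ?_
    rw [mul_pow ‖z‖]
    calc (m ^ 2 * (1 + t ^ 2)) ^ 2 = (m ^ 2 * (1 + t ^ 2)) * (m ^ 2 * (1 + t ^ 2)) := by ring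
      _ ≤ _ := by gcongr
  have hG1 := Real.Gamma_pos_of_pos (show 0 < a - c + 1 by linarith)
  have hG2 := Real.Gamma_pos_of_pos (show 0 < b - c by linarith)
  rw [hG, norm_div, norm_mul, norm_div]
  calc ‖Complex.Gamma (z + 1)‖ / ‖z‖ * ‖Complex.Gamma (b - s)‖ / ‖s‖
      = ‖Complex.Gamma (z + 1)‖ * ‖Complex.Gamma (b - s)‖ / (‖z‖ * ‖s‖) := by
        field_simp
    _ ≤ Real.Gamma (a - c + 1) * Real.Gamma (b - c) / (m ^ 2 * (1 + t ^ 2)) := by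
        gcongr
    _ = _ := by field_simp

/-! ### Products of independent Gamma variables -/

/-- The law of the product of independent `Gamma(a, 1)` and `Gamma(b, 1)` variables. -/
noncomputable def gammaProductMeasure (a b : ℝ) : Measure ℝ :=
  ((gammaMeasure a 1).prod (gammaMeasure b 1)).map fun p => p.1 * p.2

section GammaProduct

variable {a b : ℝ}

lemma isProbabilityMeasure_gammaProductMeasure (ha : 0 < a) (hb : 0 < b) :
    IsProbabilityMeasure (gammaProductMeasure a b) := by
  have := isProbabilityMeasure_gammaMeasure ha one_pos
  have := isProbabilityMeasure_gammaMeasure hb one_pos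
  exact Measure.isProbabilityMeasure_map (by fun_prop)

lemma ae_pos_prod_gammaMeasure (ha : 0 < a) (hb : 0 < b) :
    ∀ᵐ p ∂(gammaMeasure a 1).prod (gammaMeasure b 1), 0 < p.1 ∧ 0 < p.2 := by
  have := isProbabilityMeasure_gammaMeasure ha one_pos
  have := isProbabilityMeasure_gammaMeasure hb one_pos
  have h : ∀ d : ℝ, ∀ᵐ x ∂gammaMeasure d 1, 0 < x := fun d => by
    rw [ae_iff]
    simpa [Set.Iic] using gammaMeasure_Iic_zero d 1
  exact (Measure.quasiMeasurePreserving_fst.ae (h a)).and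
    (Measure.quasiMeasurePreserving_snd.ae (h b))

lemma gammaProductMeasure_Iic_zero (ha : 0 < a) (hb : 0 < b) :
    gammaProductMeasure a b (Set.Iic 0) = 0 := by
  rw [gammaProductMeasure, Measure.map_apply (by fun_prop) measurableSet_Iic]
  refine measure_mono_null ?_ (ae_iff.1 (ae_pos_prod_gammaMeasure ha hb))
  intro p hp h
  exact (mul_pos h.1 h.2).not_ge hp

/-- Given a nonzero first factor `y`, only the second factor `x / y` yields the product `x`, and
single points are null for the Gamma law. -/
lemma nullSingletonClass_gammaProductMeasure (ha : 0 < a) (hb : 0 < b) :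
    NullSingletonClass (gammaProductMeasure a b) where
  measure_singleton x := by
    have := isProbabilityMeasure_gammaMeasure ha one_pos
    have := isProbabilityMeasure_gammaMeasure hb one_pos
    have hm : Measurable fun p : ℝ × ℝ => p.1 * p.2 := by fun_prop
    rw [gammaProductMeasure, Measure.map_apply hm (measurableSet_singleton x),
      Measure.measure_prod_null (hm (measurableSet_singleton x))]
    have h0 : ∀ᵐ y ∂gammaMeasure a 1, y ≠ 0 := by
      rw [ae_iff]
      simp
    filter_upwards [h0] with y hy
    refine measure_mono_null (t := {x / y}) ?_ (measure_singleton _)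
    intro z hz
    have hz' : y * z = x := hz
    rw [Set.mem_singleton_iff, ← hz', mul_div_cancel_left₀ _ hy]

lemma integrable_rpow_neg_gammaProductMeasure {c : ℝ} (ha : 0 < a) (hb : 0 < b) (hca : c < a)
    (hcb : c < b) : Integrable (fun w => w ^ (-c)) (gammaProductMeasure a b) := by
  have := isProbabilityMeasure_gammaMeasure ha one_pos
  have := isProbabilityMeasure_gammaMeasure hb one_pos
  rw [gammaProductMeasure, integrable_map_measure
    (by fun_prop : Measurable fun w : ℝ => w ^ (-c)).aestronglyMeasurable (by fun_prop)]
  refine ((integrable_rpow_neg_gammaMeasure ha hca).mul_prod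
    (integrable_rpow_neg_gammaMeasure hb hcb)).congr ?_
  filter_upwards [ae_pos_prod_gammaMeasure ha hb] with p hp
  exact (Real.mul_rpow hp.1.le hp.2.le).symm

lemma integral_cpow_neg_gammaProductMeasure {s : ℂ} (ha : 0 < a) (hb : 0 < b) (hsa : s.re < a)
    (hsb : s.re < b) :
    ∫ w, (w : ℂ) ^ (-s) ∂gammaProductMeasure a b =
      Complex.Gamma (a - s) / Complex.Gamma a * (Complex.Gamma (b - s) / Complex.Gamma b) := by
  have := isProbabilityMeasure_gammaMeasure ha one_pos
  have := isProbabilityMeasure_gammaMeasure hb one_pos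
  rw [gammaProductMeasure, integral_map (by fun_prop)
    (by fun_prop : Measurable fun w : ℝ => (w : ℂ) ^ (-s)).aestronglyMeasurable,
    ← integral_cpow_neg_gammaMeasure ha hsa, ← integral_cpow_neg_gammaMeasure hb hsb,
    ← integral_prod_mul]
  refine integral_congr_ae ?_
  filter_upwards [ae_pos_prod_gammaMeasure ha hb] with p hp
  rw [Complex.ofReal_mul, Complex.mul_cpow_ofReal_nonneg hp.1.le hp.2.le]

end GammaProduct

/-! ### The Meijer G-function as a distribution function -/

lemma meijerGSeparates_keyhole {NT NR : ℕ} {c : ℝ}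
    (h : MeijerGSeparates 2 1 ![(1 : ℂ)] ![(NT : ℂ), (NR : ℂ), 0] c) :
    0 < c ∧ c < NT ∧ c < NR := by
  refine ⟨?_, ?_, ?_⟩
  · simpa using h.2 0 (by simp) 0
  · simpa using h.1 0 (by simp) 0
  · simpa using h.1 1 (by simp) 0

lemma exists_meijerGSeparates_keyhole {NT NR : ℕ} (hNT : 0 < NT) (hNR : 0 < NR) :
    ∃ c : ℝ, MeijerGSeparates 2 1 ![(1 : ℂ)] ![(NT : ℂ), (NR : ℂ), 0] c := by
  have hT : (1 : ℝ) ≤ NT := by exact_mod_cast hNT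
  have hR : (1 : ℝ) ≤ NR := by exact_mod_cast hNR
  refine ⟨1 / 2, fun j hj k => ?_, fun j _ k => ?_⟩
  · have hk : (0 : ℝ) ≤ k := k.cast_nonneg
    fin_cases j
    · simp
      linarith
    · simp
      linarith
    · simp at hj
  · have hk : (0 : ℝ) ≤ k := k.cast_nonneg
    fin_cases j
    simp
    linarith

/-- The parameters `a₁ = 1` and `b₃ = 0` contribute `Γ(s) / Γ(1 + s) = 1 / s`. -/
lemma meijerGIntegrand_keyhole (NT NR : ℕ) {z s : ℂ} (hs : 0 < s.re) :
    meijerGIntegrand 2 1 ![(1 : ℂ)] ![(NT : ℂ), (NR : ℂ), 0] z s =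
      Complex.Gamma (NT - s) * Complex.Gamma (NR - s) / s * z ^ s := by
  have hG := Complex.Gamma_ne_zero_of_re_pos hs
  have hs0 : s ≠ 0 := fun h => by simp [h] at hs
  have h1 : Complex.Gamma (1 + s) = s * Complex.Gamma s := by
    rw [add_comm, Complex.Gamma_add_one s hs0]
  have h : Complex.Gamma (NT - s) * Complex.Gamma (NR - s) * (Complex.Gamma (1 + s))⁻¹ *
      Complex.Gamma s = Complex.Gamma (NT - s) * Complex.Gamma (NR - s) / s := by
    rw [h1]
    field_simp
  rw [← h]
  simp [meijerGIntegrand, Fin.prod_univ_three]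

/-- Along every separating line, the Mellin-Barnes integral converges to the distribution function
of a product of independent Gamma variables. -/
lemma integrable_and_meijerGLine_keyhole {NT NR : ℕ} (hNT : 0 < NT) (hNR : 0 < NR) {x : ℝ}
    (hx : 0 < x) {c : ℝ}
    (hc : MeijerGSeparates 2 1 ![(1 : ℂ)] ![(NT : ℂ), (NR : ℂ), 0] c) :
    Integrable (fun t : ℝ => meijerGIntegrand 2 1 ![(1 : ℂ)] ![(NT : ℂ), (NR : ℂ), 0] x
      ((c : ℂ) + (t : ℂ) * Complex.I)) ∧
    meijerGLine 2 1 ![(1 : ℂ)] ![(NT : ℂ), (NR : ℂ), 0] c x =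
      Complex.Gamma NT * Complex.Gamma NR *
        (gammaProductMeasure NR NT).real (Set.Iio x) := by
  obtain ⟨hc0, hcT, hcR⟩ := meijerGSeparates_keyhole hc
  have hT : (0 : ℝ) < NT := by exact_mod_cast hNT
  have hR : (0 : ℝ) < NR := by exact_mod_cast hNR
  have := isProbabilityMeasure_gammaProductMeasure hR hT
  have := nullSingletonClass_gammaProductMeasure hR hT
  have hGT : Complex.Gamma NT ≠ 0 := Complex.Gamma_ne_zero_of_re_pos (by simpa using hNT)
  have hGR : Complex.Gamma NR ≠ 0 := Complex.Gamma_ne_zero_of_re_pos (by simpa using hNR)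
  have hint := integrable_Gamma_mul_Gamma_div hc0 hcT hcR
  have hkey : ∀ t : ℝ, meijerGIntegrand 2 1 ![(1 : ℂ)] ![(NT : ℂ), (NR : ℂ), 0] x
      ((c : ℂ) + (t : ℂ) * Complex.I) =
      (Complex.Gamma NT * Complex.Gamma NR) *
        ((Complex.Gamma NT * Complex.Gamma NR)⁻¹ *
          (Complex.Gamma (NT - (c + t * Complex.I)) * Complex.Gamma (NR - (c + t * Complex.I))) /
          (c + t * Complex.I) * (x : ℂ) ^ (c + t * Complex.I)) := by
    intro t
    rw [meijerGIntegrand_keyhole NT NR (by simpa using hc0)]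
    field_simp
  obtain ⟨h1, h2⟩ := inverse_mellin_cdf (gammaProductMeasure_Iic_zero hR hT) hc0
    (integrable_rpow_neg_gammaProductMeasure hR hT hcR hcT)
    (M := fun s => (Complex.Gamma NT * Complex.Gamma NR)⁻¹ *
      (Complex.Gamma (NT - s) * Complex.Gamma (NR - s)))
    (fun s hs => by
      rw [integral_cpow_neg_gammaProductMeasure hR hT (hs ▸ hcR) (hs ▸ hcT)]
      simp only [Complex.ofReal_natCast]
      field_simp)
    ((hint.const_mul (Complex.Gamma NT * Complex.Gamma NR)⁻¹).congr
      (ae_of_all _ fun t => by simp only [Complex.ofReal_natCast]; ring)) hx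
  constructor
  · simp_rw [hkey]
    exact h1.const_mul _
  · rw [meijerGLine]
    simp_rw [hkey]
    rw [integral_const_mul, ← h2]
    ring

lemma meijerG_keyhole {NT NR : ℕ} (hNT : 0 < NT) (hNR : 0 < NR) {x : ℝ} (hx : 0 < x) :
    meijerG 2 1 ![(1 : ℂ)] ![(NT : ℂ), (NR : ℂ), 0] x =
      Complex.Gamma NT * Complex.Gamma NR *
        (gammaProductMeasure NR NT).real (Set.Iio x) := by
  have h := exists_meijerGSeparates_keyhole hNT hNR
  rw [meijerG, dif_pos h]
  exact (integrable_and_meijerGLine_keyhole hNT hNR hx h.choose_spec).2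

/-- No contour shift is needed: on each separating line the integral equals the same expression, in
which `c` does not occur. -/
lemma meijerGWellDefined_keyhole {NT NR : ℕ} (hNT : 0 < NT) (hNR : 0 < NR) {x : ℝ} (hx : 0 < x) :
    MeijerGWellDefined 2 1 ![(1 : ℂ)] ![(NT : ℂ), (NR : ℂ), 0] x := by
  refine ⟨exists_meijerGSeparates_keyhole hNT hNR, fun c hc => ?_⟩
  have h := integrable_and_meijerGLine_keyhole hNT hNR hx hc
  exact ⟨h.1, h.2.trans (meijerG_keyhole hNT hNR hx).symm⟩

/-! ### Keyhole channels and outage -/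

/-- Since `H Hᴴ = ‖v‖² u uᴴ`, this is a rank-one perturbation of the identity, and `det (1 + x yᴴ) =
1 + yᴴ x` applies. -/
lemma det_one_add_keyholeChannel {NR NT : ℕ} (γ : ℝ) (u : Fin NR → ℂ) (v : Fin NT → ℂ) :
    (1 + (γ : ℂ) • (keyholeChannel u v * (keyholeChannel u v).conjTranspose)).det =
      ((1 + γ * ((∑ i, Complex.normSq (u i)) * ∑ j, Complex.normSq (v j)) : ℝ) : ℂ) := by
  have h : (γ : ℂ) • (keyholeChannel u v * (keyholeChannel u v).conjTranspose) =
      Matrix.replicateCol Unit (((γ * ∑ j, Complex.normSq (v j) : ℝ) : ℂ) • u) *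
        Matrix.replicateRow Unit (star u) := by
    ext i j
    simp only [keyholeChannel, Matrix.smul_apply, Matrix.mul_apply, Matrix.vecMulVec_apply,
      Matrix.conjTranspose_apply, Matrix.replicateCol_apply, Matrix.replicateRow_apply,
      Pi.smul_apply, Pi.star_apply, smul_eq_mul, Finset.univ_unique, Finset.sum_const,
      Finset.card_singleton, one_smul, star_mul', star_star]
    push_cast
    simp_rw [Complex.normSq_eq_conj_mul_self, Finset.mul_sum, Finset.sum_mul]
    refine Finset.sum_congr rfl fun k _ => ?_
    simp only [RCLike.star_def]
    ring
  rw [h, Matrix.det_one_add_replicateCol_mul_replicateRow, dotProduct]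
  push_cast
  simp_rw [Complex.normSq_eq_conj_mul_self, Finset.sum_mul, Finset.mul_sum]
  congr 1
  refine Finset.sum_congr rfl fun k _ => ?_
  simp only [Pi.smul_apply, Pi.star_apply, smul_eq_mul, RCLike.star_def, Finset.sum_mul,
    Finset.mul_sum]
  refine Finset.sum_congr rfl fun l _ => ?_
  ring

lemma mutualInfo_keyholeChannel {NR NT : ℕ} (γ : ℝ) (u : Fin NR → ℂ) (v : Fin NT → ℂ) :
    mutualInfo γ (keyholeChannel u v) =
      Real.logb 2 (1 + γ / NT * ((∑ i, Complex.normSq (u i)) * ∑ j, Complex.normSq (v j))) := by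
  rw [mutualInfo, det_one_add_keyholeChannel, Complex.ofReal_re]

lemma mutualInfo_keyholeChannel_lt_iff {NR NT : ℕ} (hNT : 0 < NT) {γ R : ℝ} (hγ : 0 < γ)
    (u : Fin NR → ℂ) (v : Fin NT → ℂ) :
    mutualInfo γ (keyholeChannel u v) < R ↔
      (∑ i, Complex.normSq (u i)) * ∑ j, Complex.normSq (v j) < NT / γ * ((2 : ℝ) ^ R - 1) := by
  have hT : (0 : ℝ) < NT := by exact_mod_cast hNT
  have hu : 0 ≤ ∑ i, Complex.normSq (u i) := Finset.sum_nonneg fun i _ => Complex.normSq_nonneg _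
  have hv : 0 ≤ ∑ j, Complex.normSq (v j) := Finset.sum_nonneg fun j _ => Complex.normSq_nonneg _
  rw [mutualInfo_keyholeChannel, Real.logb_lt_iff_lt_rpow one_lt_two (by positivity),
    ← lt_sub_iff_add_lt', ← lt_div_iff₀' (by positivity), div_div_eq_mul_div, div_mul_eq_mul_div,
    mul_comm (_ - 1)]

lemma measurable_mutualInfo {NR NT : ℕ} (γ : ℝ) :
    Measurable (mutualInfo γ : Matrix (Fin NR) (Fin NT) ℂ → ℝ) := by
  have hentry : ∀ i j, Measurable fun H : Matrix (Fin NR) (Fin NT) ℂ => H i j := fun i j =>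
    (measurable_pi_apply j).comp (measurable_pi_apply i)
  have hdet : Measurable fun H : Matrix (Fin NR) (Fin NT) ℂ =>
      (1 + ((γ / NT : ℝ) : ℂ) • (H * H.conjTranspose)).det := by
    simp only [Matrix.det_apply, Matrix.add_apply, Matrix.smul_apply, Matrix.mul_apply,
      Matrix.conjTranspose_apply]
    fun_prop
  exact (Real.measurable_log.comp (Complex.measurable_re.comp hdet)).div_const _

/-- The squared norms of `u` and `v` multiply to a product of independent Gamma variables. -/
lemma hasLaw_sum_normSq_mul_sum_normSq {Ω : Type*} [MeasurableSpace Ω] {P : Measure Ω}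
    [IsProbabilityMeasure P] {NR NT : ℕ} (hNR : 0 < NR) (hNT : 0 < NT) {u : Ω → Fin NR → ℂ}
    {v : Ω → Fin NT → ℂ} (hu : HasLaw u (complexGaussianVector NR) P)
    (hv : HasLaw v (complexGaussianVector NT) P) (huv : IndepFun u v P) :
    HasLaw (fun ω => (∑ i, Complex.normSq (u ω i)) * ∑ j, Complex.normSq (v ω j))
      (gammaProductMeasure NR NT) P := by
  have hm : ∀ N : ℕ, Measurable fun u : Fin N → ℂ => ∑ i, Complex.normSq (u i) := fun N =>
    Finset.measurable_sum _ fun i _ =>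
      Complex.continuous_normSq.measurable.comp (measurable_pi_apply i)
  have := isProbabilityMeasure_gammaMeasure (a := NR) (r := 1) (by exact_mod_cast hNR) one_pos
  have := isProbabilityMeasure_gammaMeasure (a := NT) (r := 1) (by exact_mod_cast hNT) one_pos
  exact (huv.comp (hm NR) (hm NT)).hasLaw_fun_mul
    ((hasLaw_sum_normSq_complexGaussianVector hNR).comp hu)
    ((hasLaw_sum_normSq_complexGaussianVector hNT).comp hv)

theorem mainTheorem1 {Ω : Type*} [MeasurableSpace Ω] (P : Measure Ω) [IsProbabilityMeasure P]
    (K NT NR : ℕ) [NeZero K] (hNT : 0 < NT) (hNR : 0 < NR)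
    (γ : Fin K → ℝ) (hγ : ∀ k, 0 < γ k) (R : ℝ) (hR : 0 < R)
    (u : Fin K → Ω → Fin NR → ℂ) (v : Fin K → Ω → Fin NT → ℂ)
    (hu : ∀ k, HasLaw (u k) (complexGaussianVector NR) P)
    (hv : ∀ k, HasLaw (v k) (complexGaussianVector NT) P)
    (huv : ∀ k, IndepFun (u k) (v k) P)
    (hH : iIndepFun (fun k ω => keyholeChannel (u k ω) (v k ω)) P) :
    (∀ k, MeijerGWellDefined 2 1 ![(1 : ℂ)] ![(NT : ℂ), (NR : ℂ), 0]
      ((NT / γ k * ((2 : ℝ) ^ R - 1) : ℝ) : ℂ)) ∧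
    (outageProbability P γ (fun k ω => keyholeChannel (u k ω) (v k ω)) R : ℂ) =
      1 / (Complex.Gamma NT * Complex.Gamma NR) ^ K *
        ∏ k, meijerG 2 1 ![(1 : ℂ)] ![(NT : ℂ), (NR : ℂ), 0]
          ((NT / γ k * ((2 : ℝ) ^ R - 1) : ℝ) : ℂ) := by
  have hT : (0 : ℝ) < NT := by exact_mod_cast hNT
  have h2R : (0 : ℝ) < 2 ^ R - 1 := sub_pos.2 (Real.one_lt_rpow one_lt_two hR)
  have hx : ∀ k, 0 < NT / γ k * ((2 : ℝ) ^ R - 1) := fun k =>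
    mul_pos (div_pos hT (hγ k)) h2R
  refine ⟨fun k => meijerGWellDefined_keyhole hNT hNR (hx k), ?_⟩
  have hGT : Complex.Gamma NT ≠ 0 := Complex.Gamma_ne_zero_of_re_pos (by simpa using hNT)
  have hGR : Complex.Gamma NR ≠ 0 := Complex.Gamma_ne_zero_of_re_pos (by simpa using hNR)
  have hset : {ω | typeIMutualInfo γ (fun k => keyholeChannel (u k ω) (v k ω)) < R} =
      ⋂ k, {ω | mutualInfo (γ k) (keyholeChannel (u k ω) (v k ω)) < R} := by
    ext ω
    simp [typeIMutualInfo]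
  have hround : ∀ k, P.real {ω | mutualInfo (γ k) (keyholeChannel (u k ω) (v k ω)) < R} =
      (gammaProductMeasure NR NT).real (Set.Iio (NT / γ k * ((2 : ℝ) ^ R - 1))) := by
    intro k
    simp_rw [mutualInfo_keyholeChannel_lt_iff hNT (hγ k)]
    exact (hasLaw_sum_normSq_mul_sum_normSq hNR hNT (hu k) (hv k) (huv k)).measureReal_eq
      measurableSet_Iio
  have hprod : outageProbability P γ (fun k ω => keyholeChannel (u k ω) (v k ω)) R =
      ∏ k, (gammaProductMeasure NR NT).real (Set.Iio (NT / γ k * ((2 : ℝ) ^ R - 1))) := by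
    simp_rw [outageProbability, hset, ← hround, measureReal_def]
    rw [← ENNReal.toReal_prod]
    -- Only the matrices are assumed jointly independent, so each failure event is presented as the
    -- preimage of a measurable set of matrices.
    exact congrArg ENNReal.toReal (hH.meas_iInter fun k =>
      ⟨{H | mutualInfo (γ k) H < R},
        measurableSet_lt (measurable_mutualInfo (γ k)) measurable_const, rfl⟩)
  rw [hprod]
  simp_rw [fun k => meijerG_keyhole hNT hNR (hx k)]
  rw [Finset.prod_mul_distrib, Finset.prod_const, Finset.card_univ, Fintype.card_fin]
  push_cast
  field_simp
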